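/- Let $\mathbb{K}$ be a field, let $n\ge 3$ and $s\ge 1$ be integers, and let $G=W(C_n)$ be the whiskered $n$-cycle: its vertices are $x_1,\dots,x_{2n}$, the vertices of the $n$-cycle are (in order) $x_1,\dots,x_n$, and besides the edges of this cycle $G$ has exactly the whiskers $\{x_1,x_{n+1}\},\dots,\{x_n,x_{2n}\}$ as edges. Let $I=I(G)=(x_ix_j : \{x_i,x_j\}\in E(G))$ be its edge ideal in $\mathbb{K}[x_1,\dots,x_{2n}]$, with the convention that $I^0$ is the whole ring, and let the monomial $M$ be a minimal monomial generator of $I^s$. Then $x_{n+1}^2\in(I^{s+1}:M)$ if and only if $n$ is odd, say $n=2m-1$, for some $2\le m\le s$ and $$M=(x_1x_2)(x_3x_4)\cdots(x_{2m-3}x_{2m-2})(x_{2m-1}x_1)\,N$$ for some $N\in I^{s-m}$. Moreover, in this case $x_{n+1}x_j\in(I^{s+1}:M)$ for all $j=1,\dots,2n$. -/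

import Mathlib

/-- The graph `W(G)` obtained from `G` by adding a whisker at every vertex: the vertices of `G` are
`Sum.inl v`, the new vertex attached to `v` is `Sum.inr v`, and the edges are those of `G` together
with the whiskers `{inl v, inr v}`. -/
def SimpleGraph.whiskering {V : Type*} (G : SimpleGraph V) : SimpleGraph (V ⊕ V) where
  Adj a b := match a, b with
    | Sum.inl u, Sum.inl v => G.Adj u v
    | Sum.inl u, Sum.inr v => u = v
    | Sum.inr u, Sum.inl v => u = v
    | Sum.inr _, Sum.inr _ => False
  symm := by
    constructor
    rintro (u | u) (v | v) h
    · exact h.symm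
    · exact Eq.symm h
    · exact Eq.symm h
    · exact h
  loopless := by
    constructor
    rintro (u | u) h
    · exact G.loopless.irrefl u h
    · exact h

/-- The edge ideal `I(G) = (x_u x_v : {u, v} ∈ E(G))` in the polynomial ring over `K` whose
variables are the vertices of `G`. -/
noncomputable def SimpleGraph.edgeIdeal (K : Type*) [Field K] {V : Type*} (G : SimpleGraph V) :
    Ideal (MvPolynomial V K) :=
  Ideal.span {f | ∃ u v : V, G.Adj u v ∧ f = MvPolynomial.X u * MvPolynomial.X v}

/-- `M` is a minimal (monomial) generator of the monomial ideal `J`: it is a monomial lying in `J`,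
and no monomial in `J` other than `M` itself divides it. -/
def IsMinimalMonomialGenerator {K : Type*} [Field K] {V : Type*}
    (J : Ideal (MvPolynomial V K)) (M : MvPolynomial V K) : Prop :=
  ∃ a : V →₀ ℕ, M = MvPolynomial.monomial a 1 ∧ M ∈ J ∧
    ∀ b : V →₀ ℕ, b ≤ a → MvPolynomial.monomial b (1 : K) ∈ J → b = a

/-- The labelling of the vertices of `W(C_n)` by `1, …, 2n`: the labels `1, …, n` are the vertices
of the cycle in order, and for `1 ≤ i ≤ n` the label `n + i` is the whisker vertex attached to the
cycle vertex with label `i`. (Labels outside `1, …, 2n` are never used.) -/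
def whiskeredCycleVertex (n : ℕ) [NeZero n] (j : ℕ) : Fin n ⊕ Fin n :=
  if j ≤ n then Sum.inl (Fin.ofNat n (j - 1)) else Sum.inr (Fin.ofNat n (j - n - 1))

/-- The variable `x_j` of the polynomial ring of `W(C_n)`, for a label `1 ≤ j ≤ 2n`. -/
noncomputable def whiskeredCycleVar (K : Type*) [Field K] (n : ℕ) [NeZero n] (j : ℕ) :
    MvPolynomial (Fin n ⊕ Fin n) K :=
  MvPolynomial.X (whiskeredCycleVertex n j)

open MvPolynomial

/-! Write `M` as a product of `s` edges with multiplicities `c`. If `x_{n+1}^2 M` lies in `I^{s+1}`,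
some product of `s + 1` edges, with multiplicities `d`, divides it; both have degree `2s + 2`, so
they are equal. Exponents at the whisker vertices determine `d - c` on the whiskers. At the cycle
vertices, consecutive values of `d - c` on cycle edges then sum to `0`, except at `x_1`, where they
sum to `-2`. Hence they alternate in sign around the cycle, which is impossible for even `n` and
forces `-1` on every other edge for odd `n`; those edges therefore occur in `M`
(`odd_and_pos_of_sum_eq`, `exists_factorization`).

Conversely, these edges multiply to `x_1 · (x_1 ⋯ x_n)`. Pair the extra `x_1` with `x_{n+1}`, pair
`x_j` with a neighbour on the cycle, and split the remaining path into edges: one edge is gained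
(`var_mul_var_mem_colon`). -/

theorem Ideal.prod_pow_mem_pow {R ι : Type*} [CommSemiring R] (I : Ideal R) (t : Finset ι)
    (f : ι → R) (hf : ∀ i ∈ t, f i ∈ I) (c : ι → ℕ) :
    ∏ i ∈ t, f i ^ c i ∈ I ^ (∑ i ∈ t, c i) := by
  rw [← Finset.prod_pow_eq_pow_sum]
  exact Ideal.prod_mem_prod fun i hi => Ideal.pow_mem_pow (hf i hi) _

theorem Ideal.prod_mem_pow_card {R ι : Type*} [CommSemiring R] (I : Ideal R) (t : Finset ι)
    (f : ι → R) (hf : ∀ i ∈ t, f i ∈ I) : ∏ i ∈ t, f i ∈ I ^ t.card := by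
  simpa using I.prod_pow_mem_pow t f hf fun _ => 1

/-! ### Powers of finitely generated monomial ideals -/

section MonomialPowers

variable {K ι σ : Type*} [Field K] [Fintype ι]

/-- A power of the ideal generated by the monomials with exponents `g i` is generated by the
monomials whose exponents are sums of the `g i` with multiplicity. -/
theorem span_monomial_pow_le (g : ι → σ →₀ ℕ) (s : ℕ) :
    (Ideal.span (Set.range fun i => monomial (g i) (1 : K))) ^ s ≤
      Ideal.span ((fun a => monomial a (1 : K)) ''
        {a | ∃ c : ι → ℕ, ∑ i, c i = s ∧ a = ∑ i, c i • g i}) := by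
  classical
  induction s with
  | zero =>
    rw [pow_zero, Ideal.one_eq_top, top_le_iff, Ideal.eq_top_iff_one]
    exact Ideal.subset_span ⟨0, ⟨0, by simp, by simp⟩, rfl⟩
  | succ s ih =>
    rw [pow_succ]
    refine (Ideal.mul_mono_left ih).trans ?_
    rw [Ideal.span_mul_span', Ideal.span_le]
    rintro _ ⟨_, ⟨_, ⟨c, hc, rfl⟩, rfl⟩, _, ⟨i, rfl⟩, rfl⟩
    refine Ideal.subset_span ⟨_, ⟨c + Pi.single i 1, ?_, rfl⟩, ?_⟩
    · simp [Finset.sum_add_distrib, hc]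
    · simp only [monomial_mul, mul_one, Pi.add_apply, add_smul, Finset.sum_add_distrib]
      congr 2
      simp [Pi.single_apply, ite_smul]

theorem exists_sum_le_of_monomial_mem_pow {g : ι → σ →₀ ℕ} {s : ℕ} {a : σ →₀ ℕ}
    (h : monomial a (1 : K) ∈ (Ideal.span (Set.range fun i => monomial (g i) (1 : K))) ^ s) :
    ∃ c : ι → ℕ, ∑ i, c i = s ∧ ∑ i, c i • g i ≤ a := by
  classical
  obtain ⟨b, ⟨c, hc, rfl⟩, hle⟩ := mem_ideal_span_monomial_image.1
    (span_monomial_pow_le g s h) a (by simp)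
  exact ⟨c, hc, hle⟩

theorem monomial_sum_smul (g : ι → σ →₀ ℕ) (c : ι → ℕ) :
    monomial (∑ i, c i • g i) (1 : K) = ∏ i, monomial (g i) (1 : K) ^ c i := by
  simp [monomial_pow, monomial_sum_one]

theorem monomial_sum_mem_pow (g : ι → σ →₀ ℕ) (c : ι → ℕ) :
    monomial (∑ i, c i • g i) (1 : K) ∈
      (Ideal.span (Set.range fun i => monomial (g i) (1 : K))) ^ (∑ i, c i) := by
  rw [monomial_sum_smul]
  exact Ideal.prod_pow_mem_pow _ _ _ (fun i _ => Ideal.subset_span (Set.mem_range_self i)) c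

/-- Some product of `s` generators divides `M` and itself lies in the power, so minimality makes it
equal to `M`. -/
theorem IsMinimalMonomialGenerator.exists_eq_sum {g : ι → σ →₀ ℕ} {s : ℕ} {M : MvPolynomial σ K}
    (h : IsMinimalMonomialGenerator
      ((Ideal.span (Set.range fun i => monomial (g i) (1 : K))) ^ s) M) :
    ∃ c : ι → ℕ, ∑ i, c i = s ∧ M = monomial (∑ i, c i • g i) 1 := by
  obtain ⟨a, rfl, hM, hmin⟩ := h
  obtain ⟨c, rfl, hle⟩ := exists_sum_le_of_monomial_mem_pow hM
  exact ⟨c, rfl, by rw [hmin _ hle (monomial_sum_mem_pow g c)]⟩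

end MonomialPowers

/-! ### Edge exponents and vertex sums on the whiskered cycle -/

section WhiskeredCycle

theorem whisker_edge_mem (n : ℕ) (K : Type*) [Field K] (i : Fin n) :
    (X (Sum.inl i) * X (Sum.inr i) : MvPolynomial (Fin n ⊕ Fin n) K) ∈
      (SimpleGraph.cycleGraph n).whiskering.edgeIdeal K :=
  Ideal.subset_span ⟨Sum.inl i, Sum.inr i, rfl, rfl⟩

variable (n : ℕ) [NeZero n]

/-- The exponents of the edges of `W(C_n)`: `inl i` is the cycle edge from `i` to `i + 1`, and
`inr i` is the whisker at `i`. -/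
noncomputable def whiskeredCycleEdge : Fin n ⊕ Fin n → (Fin n ⊕ Fin n →₀ ℕ)
  | Sum.inl i => Finsupp.single (Sum.inl i) 1 + Finsupp.single (Sum.inl (i + 1)) 1
  | Sum.inr i => Finsupp.single (Sum.inl i) 1 + Finsupp.single (Sum.inr i) 1

theorem degree_whiskeredCycleEdge (e : Fin n ⊕ Fin n) : (whiskeredCycleEdge n e).degree = 2 := by
  cases e <;> simp [whiskeredCycleEdge]

theorem monomial_whiskeredCycleEdge_inl (K : Type*) [Field K] (i : Fin n) :
    monomial (whiskeredCycleEdge n (Sum.inl i)) (1 : K) = X (Sum.inl i) * X (Sum.inl (i + 1)) := by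
  simp [whiskeredCycleEdge, X, monomial_mul]

theorem monomial_whiskeredCycleEdge_inr (K : Type*) [Field K] (i : Fin n) :
    monomial (whiskeredCycleEdge n (Sum.inr i)) (1 : K) = X (Sum.inl i) * X (Sum.inr i) := by
  simp [whiskeredCycleEdge, X, monomial_mul]

theorem cycleGraph_adj_add_one (hn : 3 ≤ n) (i : Fin n) :
    (SimpleGraph.cycleGraph n).Adj i (i + 1) := by
  obtain ⟨k, rfl⟩ : ∃ k, n = k + 2 := ⟨n - 2, by omega⟩
  rw [SimpleGraph.cycleGraph_adj]
  right
  abel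

theorem whiskering_cycleGraph_edgeIdeal (K : Type*) [Field K] (hn : 3 ≤ n) :
    (SimpleGraph.cycleGraph n).whiskering.edgeIdeal K =
      Ideal.span (Set.range fun e => monomial (whiskeredCycleEdge n e) (1 : K)) := by
  refine le_antisymm (Ideal.span_le.2 ?_) (Ideal.span_le.2 ?_)
  · rintro _ ⟨u | u, v | v, h, rfl⟩
    · have h' : u = v + 1 ∨ v = u + 1 := by
        obtain ⟨k, rfl⟩ : ∃ k, n = k + 2 := ⟨n - 2, by omega⟩
        have h : (SimpleGraph.cycleGraph (k + 2)).Adj u v := h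
        rw [SimpleGraph.cycleGraph_adj, sub_eq_iff_eq_add', sub_eq_iff_eq_add'] at h
        exact h
      rcases h' with rfl | rfl
      · exact Ideal.subset_span ⟨Sum.inl v, by
          simp only [monomial_whiskeredCycleEdge_inl, mul_comm]⟩
      · exact Ideal.subset_span ⟨Sum.inl u, monomial_whiskeredCycleEdge_inl n K u⟩
    · obtain rfl : u = v := h
      exact Ideal.subset_span ⟨Sum.inr u, monomial_whiskeredCycleEdge_inr n K u⟩
    · obtain rfl : u = v := h
      exact Ideal.subset_span ⟨Sum.inr u, by
        simp only [monomial_whiskeredCycleEdge_inr, mul_comm]⟩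
    · exact h.elim
  · rintro _ ⟨i | i, rfl⟩
    · exact Ideal.subset_span ⟨Sum.inl i, Sum.inl (i + 1), cycleGraph_adj_add_one n hn i,
        monomial_whiskeredCycleEdge_inl n K i⟩
    · exact Ideal.subset_span ⟨Sum.inl i, Sum.inr i, rfl, monomial_whiskeredCycleEdge_inr n K i⟩

theorem sum_smul_whiskeredCycleEdge_inr (c : Fin n ⊕ Fin n → ℕ) (i : Fin n) :
    (∑ e, c e • whiskeredCycleEdge n e) (Sum.inr i) = c (Sum.inr i) := by
  simp [whiskeredCycleEdge, Finsupp.single_apply]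

/-- Evaluating at `i + 1` names both incident cycle edges, `inl i` and `inl (i + 1)`, without
subtraction. -/
theorem sum_smul_whiskeredCycleEdge_inl (c : Fin n ⊕ Fin n → ℕ) (i : Fin n) :
    (∑ e, c e • whiskeredCycleEdge n e) (Sum.inl (i + 1)) =
      c (Sum.inl (i + 1)) + c (Sum.inl i) + c (Sum.inr (i + 1)) := by
  simp [whiskeredCycleEdge, Finsupp.single_apply, Finset.sum_add_distrib]

theorem degree_sum_smul_whiskeredCycleEdge (c : Fin n ⊕ Fin n → ℕ) :
    (∑ e, c e • whiskeredCycleEdge n e).degree = 2 * ∑ e, c e := by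
  simp only [map_sum, map_nsmul, degree_whiskeredCycleEdge, smul_eq_mul]
  rw [← Finset.sum_mul, mul_comm]

theorem ofNat_add_one (k : ℕ) : Fin.ofNat n k + 1 = Fin.ofNat n (k + 1) := by
  ext
  simp [Fin.val_add]

/-- A vector of edge weights on `W(C_n)` whose vertex sums are `2` at the whisker vertex attached
to `0` and vanish elsewhere exists only for odd `n`; it is `-1` on every other edge of the cycle,
starting with the edge from `0` to `1`. -/
theorem odd_and_pos_of_sum_eq (hn : 3 ≤ n) (c d : Fin n ⊕ Fin n → ℕ)
    (h : ∑ e, d e • whiskeredCycleEdge n e =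
      ∑ e, c e • whiskeredCycleEdge n e + Finsupp.single (Sum.inr 0) 2) :
    Odd n ∧ ∀ k, 2 * k < n → 1 ≤ c (Sum.inl (Fin.ofNat n (2 * k))) := by
  have hr (i : Fin n) : d (Sum.inr i) = c (Sum.inr i) + if i = 0 then 2 else 0 := by
    have := DFunLike.congr_fun h (Sum.inr i)
    rw [Finsupp.add_apply, sum_smul_whiskeredCycleEdge_inr, sum_smul_whiskeredCycleEdge_inr] at this
    simpa [Finsupp.single_apply, eq_comm] using this
  have hl (i : Fin n) : d (Sum.inl (i + 1)) + d (Sum.inl i) + d (Sum.inr (i + 1)) =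
      c (Sum.inl (i + 1)) + c (Sum.inl i) + c (Sum.inr (i + 1)) := by
    have := DFunLike.congr_fun h (Sum.inl (i + 1))
    rw [Finsupp.add_apply, sum_smul_whiskeredCycleEdge_inl, sum_smul_whiskeredCycleEdge_inl] at this
    simpa [Finsupp.single_apply] using this
  set w : ℕ → ℤ := fun k =>
    (d (Sum.inl (Fin.ofNat n k)) : ℤ) - c (Sum.inl (Fin.ofNat n k)) with hw
  -- The excess `2` on the whisker at `0` must be compensated by the two cycle edges at `0`.
  have hstep (k : ℕ) : w (k + 1) + w k = if Fin.ofNat n (k + 1) = 0 then -2 else 0 := by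
    have h1 := hl (Fin.ofNat n k)
    have h2 := hr (Fin.ofNat n (k + 1))
    rw [ofNat_add_one] at h1
    simp only [hw]
    split_ifs at h2 ⊢ <;> omega
  have hne (k : ℕ) (hk : k + 1 < n) : w (k + 1) = - w k := by
    have := hstep k
    rw [if_neg] at this
    · linarith
    · intro h0
      have := congrArg Fin.val h0
      simp [Nat.mod_eq_of_lt hk] at this
  have hpow (k : ℕ) (hk : k < n) : w k = (-1) ^ k * w 0 := by
    induction k with
    | zero => simp
    | succ k ih => rw [hne k hk, ih (by omega)]; ring
  have hlast : w 0 + w (n - 1) = -2 := by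
    have := hstep (n - 1)
    rw [Nat.sub_add_cancel (by omega)] at this
    have h0 : Fin.ofNat n n = 0 := by ext; simp
    have h1 : w n = w 0 := by simp only [hw, h0]; simp
    rwa [if_pos h0, h1] at this
  rw [hpow (n - 1) (by omega)] at hlast
  have hodd : Odd n := by
    by_contra hcon
    rw [Nat.not_odd_iff_even] at hcon
    have : Odd (n - 1) := Nat.Even.sub_odd (by omega) hcon odd_one
    rw [this.neg_one_pow] at hlast
    omega
  refine ⟨hodd, fun k hk => ?_⟩
  have he : Even (n - 1) := Nat.Odd.sub_odd hodd odd_one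
  rw [he.neg_one_pow] at hlast
  -- Now `hlast` reads `2 * w 0 = -2`, so `w (2 * k) = -1`, which needs `c` positive there.
  have := hpow (2 * k) hk
  rw [(even_two_mul k).neg_one_pow] at this
  simp only [hw] at this hlast ⊢
  omega

/-! ### Products of variables around the cycle -/

variable (K : Type*) [Field K]

theorem whiskeredCycleVar_cycle {j : ℕ} (hj : j ≤ n) :
    whiskeredCycleVar K n j = X (Sum.inl (Fin.ofNat n (j - 1))) := by
  simp [whiskeredCycleVar, whiskeredCycleVertex, hj]

theorem whiskeredCycleVar_whisker {j : ℕ} (hj : n < j) :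
    whiskeredCycleVar K n j = X (Sum.inr (Fin.ofNat n (j - n - 1))) := by
  simp [whiskeredCycleVar, whiskeredCycleVertex, hj]

theorem ofNat_add_self (k : ℕ) : Fin.ofNat n (k + n) = Fin.ofNat n k := by
  ext
  simp

theorem prod_range_shift_of_periodic {R : Type*} [CommMonoid R] {f : ℕ → R} {p : ℕ}
    (hf : Function.Periodic f p) (j : ℕ) :
    ∏ k ∈ Finset.range p, f (j + k) = ∏ k ∈ Finset.range p, f k := by
  induction j with
  | zero => simp
  | succ j ih =>
    rw [← ih]
    rcases p with _ | p
    · simp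
    · rw [Finset.prod_range_succ, Finset.prod_range_succ' (fun k => f (j + k))]
      congr 1
      · exact Finset.prod_congr rfl fun k _ => by congr 1; ring
      · rw [← hf (j + 0)]; congr 1; ring

theorem prod_range_two_mul {R : Type*} [CommMonoid R] (f : ℕ → R) (r : ℕ) :
    ∏ k ∈ Finset.range (2 * r), f k = ∏ k ∈ Finset.range r, (f (2 * k) * f (2 * k + 1)) := by
  induction r with
  | zero => simp
  | succ r ih => rw [mul_add_one, Finset.prod_range_succ, Finset.prod_range_succ, ih,
      Finset.prod_range_succ, mul_assoc]

/-- The product `(x_1x_2)(x_3x_4)⋯(x_{2m-1}x_1)`, as a product over every other edge of the cycle. -/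
theorem prod_whiskeredCycleVar {m : ℕ} (hm : 2 ≤ m) (hnm : n = 2 * m - 1) :
    (∏ i ∈ Finset.Icc 1 (m - 1),
        (whiskeredCycleVar K n (2 * i - 1) * whiskeredCycleVar K n (2 * i))) *
          (whiskeredCycleVar K n (2 * m - 1) * whiskeredCycleVar K n 1) =
      ∏ k ∈ Finset.range m, ((X (Sum.inl (Fin.ofNat n (2 * k))) *
        X (Sum.inl (Fin.ofNat n (2 * k + 1))) : MvPolynomial (Fin n ⊕ Fin n) K)) := by
  obtain ⟨r, rfl⟩ : ∃ r, m = r + 1 := ⟨m - 1, by omega⟩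
  rw [Finset.prod_range_succ, Nat.add_sub_cancel, ← Finset.Ico_add_one_right_eq_Icc,
    Finset.prod_Ico_eq_prod_range, Nat.add_sub_cancel]
  congr 1
  · refine Finset.prod_congr rfl fun k hk => ?_
    rw [Finset.mem_range] at hk
    rw [whiskeredCycleVar_cycle n K (by omega), whiskeredCycleVar_cycle n K (by omega)]
    congr 4 <;> omega
  · rw [whiskeredCycleVar_cycle n K (by omega), whiskeredCycleVar_cycle n K (by omega)]
    -- Here `2 * r + 1 = n`, so the last edge closes up at `x_1`.
    have : Fin.ofNat n (2 * r + 1) = Fin.ofNat n (1 - 1) := by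
      rw [← ofNat_add_self n (1 - 1)]
      congr 1
      omega
    rw [this]
    rfl

theorem cycle_edge_mem (hn : 3 ≤ n) (k : ℕ) :
    (X (Sum.inl (Fin.ofNat n k)) * X (Sum.inl (Fin.ofNat n (k + 1))) :
      MvPolynomial (Fin n ⊕ Fin n) K) ∈ (SimpleGraph.cycleGraph n).whiskering.edgeIdeal K := by
  rw [← ofNat_add_one]
  exact Ideal.subset_span ⟨Sum.inl _, Sum.inl _, cycleGraph_adj_add_one n hn _, rfl⟩

/-- In an odd cycle, the product of all vertices but one lies in the appropriate power of the edge
ideal. -/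
theorem exists_prod_eq_mul_mem_pow (hn : 3 ≤ n) {r : ℕ} (hnr : n = 2 * r + 1) (j : ℕ) :
    ∃ Q ∈ (SimpleGraph.cycleGraph n).whiskering.edgeIdeal K ^ r,
      ∏ k ∈ Finset.range n, (X (Sum.inl (Fin.ofNat n k)) : MvPolynomial (Fin n ⊕ Fin n) K) =
        X (Sum.inl (Fin.ofNat n j)) * Q := by
  set V : ℕ → MvPolynomial (Fin n ⊕ Fin n) K := fun k => X (Sum.inl (Fin.ofNat n k)) with hV
  refine ⟨∏ k ∈ Finset.range r, (V (j + 1 + 2 * k) * V (j + 1 + 2 * k + 1)), ?_, ?_⟩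
  · have := Ideal.prod_mem_pow_card _ (Finset.range r) _
      fun k _ => cycle_edge_mem n K hn (j + 1 + 2 * k)
    rwa [Finset.card_range] at this
  · have hper : Function.Periodic V n := fun k => by simp only [hV, ofNat_add_self]
    have hsplit := prod_range_two_mul (fun k => V (j + 1 + k)) r
    simp only [← add_assoc] at hsplit
    rw [← prod_range_shift_of_periodic hper j, ← hsplit]
    rw [show Finset.range n = Finset.range (2 * r + 1) from congrArg Finset.range hnr,
      Finset.prod_range_succ', mul_comm]
    congr 1
    exact Finset.prod_congr rfl fun k _ => by congr 1; ring

/-- The product of every other edge of an odd cycle, starting and ending at the first vertex. -/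
theorem prod_alternate_edges {m : ℕ} (hm : 2 ≤ m) (hnm : n = 2 * m - 1) :
    ∏ k ∈ Finset.range m, ((X (Sum.inl (Fin.ofNat n (2 * k))) *
        X (Sum.inl (Fin.ofNat n (2 * k + 1))) : MvPolynomial (Fin n ⊕ Fin n) K)) =
      X (Sum.inl (Fin.ofNat n 0)) * ∏ k ∈ Finset.range n, X (Sum.inl (Fin.ofNat n k)) := by
  rw [← prod_range_two_mul (fun k => (X (Sum.inl (Fin.ofNat n k)) :
    MvPolynomial (Fin n ⊕ Fin n) K)), show 2 * m = n + 1 by omega, Finset.prod_range_succ,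
    ← ofNat_add_self n 0, zero_add, mul_comm]

/-- The edge count is `2 + (m - 1) + (s - m) = s + 1`: the whisker at `x_1`, an edge through `x_j`,
the rest of the cycle, and `N`. -/
theorem var_mul_var_mem_colon (hn : 3 ≤ n) {s m : ℕ} (hm : 2 ≤ m) (hms : m ≤ s)
    (hnm : n = 2 * m - 1) {N : MvPolynomial (Fin n ⊕ Fin n) K}
    (hN : N ∈ (SimpleGraph.cycleGraph n).whiskering.edgeIdeal K ^ (s - m)) (j : ℕ) :
    whiskeredCycleVar K n (n + 1) * whiskeredCycleVar K n j ∈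
      ((SimpleGraph.cycleGraph n).whiskering.edgeIdeal K ^ (s + 1)).colon
        {(∏ i ∈ Finset.Icc 1 (m - 1),
          (whiskeredCycleVar K n (2 * i - 1) * whiskeredCycleVar K n (2 * i))) *
          (whiskeredCycleVar K n (2 * m - 1) * whiskeredCycleVar K n 1) * N} := by
  rw [Submodule.mem_colon_singleton, smul_eq_mul, prod_whiskeredCycleVar n K hm hnm,
    prod_alternate_edges n K hm hnm]
  have hw := whisker_edge_mem n K (Fin.ofNat n 0)
  have hx : whiskeredCycleVar K n (n + 1) = X (Sum.inr (Fin.ofNat n 0)) := by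
    rw [whiskeredCycleVar_whisker n K (by omega)]
    congr 3
    omega
  have key : ∃ E ∈ (SimpleGraph.cycleGraph n).whiskering.edgeIdeal K,
      ∃ Q ∈ (SimpleGraph.cycleGraph n).whiskering.edgeIdeal K ^ (m - 1),
        whiskeredCycleVar K n j * ∏ k ∈ Finset.range n, X (Sum.inl (Fin.ofNat n k)) = E * Q := by
    rcases le_or_gt j n with hj | hj
    -- Label `j` has index `j - 1`; the vertex split off is its successor, which forms an edge with
    -- `x_j`.
    · obtain ⟨Q, hQ, hprod⟩ := exists_prod_eq_mul_mem_pow n K hn (r := m - 1) (by omega) (j - 1 + 1)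
      refine ⟨_, cycle_edge_mem n K hn (j - 1), Q, hQ, ?_⟩
      rw [whiskeredCycleVar_cycle n K hj, hprod, mul_assoc]
    · obtain ⟨Q, hQ, hprod⟩ := exists_prod_eq_mul_mem_pow n K hn (r := m - 1) (by omega) (j - n - 1)
      refine ⟨_, whisker_edge_mem n K (Fin.ofNat n (j - n - 1)), Q, hQ, ?_⟩
      rw [whiskeredCycleVar_whisker n K hj, hprod]
      ring
  obtain ⟨E, hE, Q, hQ, hEQ⟩ := key
  have hmem := Ideal.mul_mem_mul (Ideal.mul_mem_mul (Ideal.mul_mem_mul hw hE) hQ) hN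
  rw [← pow_two, ← pow_add, ← pow_add, show 2 + (m - 1) + (s - m) = s + 1 by omega] at hmem
  rw [hx]
  convert hmem using 1
  linear_combination (X (Sum.inr (Fin.ofNat n 0)) * X (Sum.inl (Fin.ofNat n 0)) * N) * hEQ

/-- One copy of each alternate edge can be removed from `M`, since each has positive multiplicity;
the edges left over form `N`. -/
theorem exists_factorization (hn : 3 ≤ n) (c d : Fin n ⊕ Fin n → ℕ)
    (h : ∑ e, d e • whiskeredCycleEdge n e =
      ∑ e, c e • whiskeredCycleEdge n e + Finsupp.single (Sum.inr 0) 2) :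
    ∃ m : ℕ, 2 ≤ m ∧ m ≤ ∑ e, c e ∧ n = 2 * m - 1 ∧
      ∃ N ∈ (SimpleGraph.cycleGraph n).whiskering.edgeIdeal K ^ (∑ e, c e - m),
        monomial (∑ e, c e • whiskeredCycleEdge n e) (1 : K) =
          (∏ i ∈ Finset.Icc 1 (m - 1),
            (whiskeredCycleVar K n (2 * i - 1) * whiskeredCycleVar K n (2 * i))) *
            (whiskeredCycleVar K n (2 * m - 1) * whiskeredCycleVar K n 1) * N := by
  obtain ⟨⟨r, hr⟩, hpos⟩ := odd_and_pos_of_sum_eq n hn c d h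
  set f : ℕ → Fin n ⊕ Fin n := fun k => Sum.inl (Fin.ofNat n (2 * k)) with hf
  have hinj : Set.InjOn f (Finset.range (r + 1)) := by
    intro a ha b hb hab
    simp only [Finset.coe_range, Set.mem_Iio] at ha hb
    have := congrArg Fin.val (Sum.inl_injective hab)
    simp only [Fin.val_ofNat, Nat.mod_eq_of_lt (show 2 * a < n by omega),
      Nat.mod_eq_of_lt (show 2 * b < n by omega)] at this
    omega
  set F := (Finset.range (r + 1)).image f with hF
  have hcard : F.card = r + 1 := by rw [hF, Finset.card_image_of_injOn hinj, Finset.card_range]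
  set u : Fin n ⊕ Fin n → ℕ := fun e => if e ∈ F then 1 else 0 with hu
  have hle (e : Fin n ⊕ Fin n) : u e ≤ c e := by
    simp only [hu]
    split_ifs with he
    · obtain ⟨k, hk, rfl⟩ := Finset.mem_image.1 he
      exact hpos k (by rw [Finset.mem_range] at hk; omega)
    · exact Nat.zero_le _
  have husum : ∑ e, u e = r + 1 := by simp [hu, hcard]
  have hsum : ∑ e, (c e - u e) + (r + 1) = ∑ e, c e := by
    rw [← husum, ← Finset.sum_add_distrib]
    exact Finset.sum_congr rfl fun e _ => Nat.sub_add_cancel (hle e)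
  refine ⟨r + 1, by omega, by omega, by omega,
    monomial (∑ e, (c e - u e) • whiskeredCycleEdge n e) 1, ?_, ?_⟩
  · rw [whiskering_cycleGraph_edgeIdeal n K hn, ← hsum, Nat.add_sub_cancel]
    exact monomial_sum_mem_pow (whiskeredCycleEdge n) fun e => c e - u e
  · have hprod : ∏ k ∈ Finset.range (r + 1), ((X (Sum.inl (Fin.ofNat n (2 * k))) *
        X (Sum.inl (Fin.ofNat n (2 * k + 1))) : MvPolynomial (Fin n ⊕ Fin n) K)) =
        ∏ e, monomial (whiskeredCycleEdge n e) (1 : K) ^ u e := by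
      simp only [hu, pow_ite, pow_one, pow_zero, Finset.prod_ite_mem, Finset.univ_inter]
      rw [hF, Finset.prod_image hinj]
      refine Finset.prod_congr rfl fun k _ => ?_
      rw [hf, monomial_whiskeredCycleEdge_inl, ofNat_add_one]
    rw [prod_whiskeredCycleVar n K (by omega) (by omega), hprod, monomial_sum_smul,
      monomial_sum_smul, ← Finset.prod_mul_distrib]
    exact Finset.prod_congr rfl fun e _ => by rw [← pow_add, Nat.add_sub_cancel' (hle e)]

end WhiskeredCycle

theorem lemma2p4 (K : Type*) [Field K] (n : ℕ) [NeZero n] (hn : 3 ≤ n) (s : ℕ) (hs : 1 ≤ s)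
    (I : Ideal (MvPolynomial (Fin n ⊕ Fin n) K))
    (hI : I = (SimpleGraph.cycleGraph n).whiskering.edgeIdeal K)
    (x : ℕ → MvPolynomial (Fin n ⊕ Fin n) K) (hx : x = whiskeredCycleVar K n)
    (M : MvPolynomial (Fin n ⊕ Fin n) K) (hM : IsMinimalMonomialGenerator (I ^ s) M) :
    (x (n + 1) ^ 2 ∈ (I ^ (s + 1)).colon {M} ↔
      ∃ m : ℕ, 2 ≤ m ∧ m ≤ s ∧ n = 2 * m - 1 ∧ ∃ N ∈ I ^ (s - m),
        M = (∏ i ∈ Finset.Icc 1 (m - 1), (x (2 * i - 1) * x (2 * i))) *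
          (x (2 * m - 1) * x 1) * N) ∧
    ((∃ m : ℕ, 2 ≤ m ∧ m ≤ s ∧ n = 2 * m - 1 ∧ ∃ N ∈ I ^ (s - m),
        M = (∏ i ∈ Finset.Icc 1 (m - 1), (x (2 * i - 1) * x (2 * i))) *
          (x (2 * m - 1) * x 1) * N) →
      ∀ j : ℕ, 1 ≤ j → j ≤ 2 * n → x (n + 1) * x j ∈ (I ^ (s + 1)).colon {M}) := by
  subst hI hx
  have hback : (∃ m : ℕ, 2 ≤ m ∧ m ≤ s ∧ n = 2 * m - 1 ∧
      ∃ N ∈ (SimpleGraph.cycleGraph n).whiskering.edgeIdeal K ^ (s - m),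
        M = (∏ i ∈ Finset.Icc 1 (m - 1),
          (whiskeredCycleVar K n (2 * i - 1) * whiskeredCycleVar K n (2 * i))) *
          (whiskeredCycleVar K n (2 * m - 1) * whiskeredCycleVar K n 1) * N) →
      ∀ j : ℕ, whiskeredCycleVar K n (n + 1) * whiskeredCycleVar K n j ∈
        ((SimpleGraph.cycleGraph n).whiskering.edgeIdeal K ^ (s + 1)).colon {M} := by
    rintro ⟨m, hm, hms, hnm, N, hN, rfl⟩ j
    exact var_mul_var_mem_colon n K hn hm hms hnm hN j
  refine ⟨⟨fun h => ?_, fun h => ?_⟩, fun h j _ _ => hback h j⟩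
  · rw [whiskering_cycleGraph_edgeIdeal n K hn] at hM
    obtain ⟨c, rfl, rfl⟩ := hM.exists_eq_sum
    have hx : whiskeredCycleVar K n (n + 1) ^ 2 =
        monomial (Finsupp.single (Sum.inr (0 : Fin n)) 2) (1 : K) := by
      rw [whiskeredCycleVar_whisker n K (by omega), X_pow_eq_monomial]
      have : n + 1 - n - 1 = 0 := by omega
      rw [this]
      rfl
    rw [Submodule.mem_colon_singleton, smul_eq_mul, hx, monomial_mul, mul_one,
      whiskering_cycleGraph_edgeIdeal n K hn] at h
    obtain ⟨d, hd, hle⟩ := exists_sum_le_of_monomial_mem_pow h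
    refine exists_factorization n K hn c d ?_
    obtain ⟨t, ht⟩ := exists_add_of_le hle
    have hdeg := congrArg Finsupp.degree ht
    rw [map_add, map_add, degree_sum_smul_whiskeredCycleEdge, degree_sum_smul_whiskeredCycleEdge,
      Finsupp.degree_single, hd] at hdeg
    -- Both edge products are accounted for by degree, so the cofactor `t` has degree `0`.
    have ht0 : t = 0 := (Finsupp.degree_eq_zero_iff t).1 (by omega)
    rw [add_comm, ht, ht0, add_zero]
  · rw [pow_two]
    exact hback h (n + 1)
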